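/- Holevo bound for partial measurements. All spaces are finite dimensional. A density matrix is a positive semidefinite complex matrix $\rho$ with $\operatorname{Tr}\rho=1$, and $S(\rho)=-\operatorname{Tr}\rho\log\rho$ is its von Neumann entropy (with $0\log 0=0$). For a finite ensemble $\mathcal E=\{\pi_j,\rho_j\}$, with $\pi_j>0$, $\sum_j\pi_j=1$ and each $\rho_j$ a density matrix, let $$\chi(\mathcal E)=S\Big(\sum_j\pi_j\rho_j\Big)-\sum_j\pi_jS(\rho_j),$$ and for a linear map $\Phi$ of matrices let $\Phi(\mathcal E)=\{\pi_j,\Phi(\rho_j)\}$. A POVM $\mathcal M=\{M_a\}$ is a finite family of positive semidefinite matrices with $\sum_aM_a=I$; its measurement map is $\Phi_{\mathcal M}(\rho)=\sum_a(\operatorname{Tr}\rho M_a)\,|a\rangle\langle a|$, where the $|a\rangle$ are the standard basis vectors of a space indexed by the outcomes. Let $\mathcal E^{AB}=\{\pi_j,\rho_j^{AB}\}$ be an ensemble on $\mathcal H_A\otimes\mathcal H_B$, and let $\mathcal M_A$, $\mathcal M_B$ be POVMs on $\mathcal H_A$ and $\mathcal H_B$. Then $$\chi(\mathcal E^{AB})\;\ge\;\chi\big[(I\otimes\Phi_{\mathcal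 M_B})(\mathcal E^{AB})\big]\;\ge\;\chi\big[(\Phi_{\mathcal M_A}\otimes\Phi_{\mathcal M_B})(\mathcal E^{AB})\big],$$ where $I$ is the identity map on the matrices on $\mathcal H_A$. -/

import Mathlib

open scoped ComplexOrder Matrix

noncomputable section

/-- A density matrix: a positive semidefinite complex matrix of trace one. -/
def IsDensityMatrix {n : Type*} [Fintype n] (ρ : Matrix n n ℂ) : Prop :=
  ρ.PosSemidef ∧ ρ.trace = 1

/-- The von Neumann entropy `S(ρ) = - Tr ρ log ρ`; the matrix logarithm is given by the
functional calculus of Hermitian matrices, and `Real.log 0 = 0` yields the usual convention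
`0 log 0 = 0`. -/
def vonNeumannEntropy {n : Type*} [Fintype n] [DecidableEq n] (ρ : Matrix n n ℂ) : ℝ :=
  -((ρ * cfc Real.log ρ).trace).re

/-- A weighted family `{π_j, ρ_j}` of square complex matrices. -/
structure WeightedFamily (ι n : Type*) where
  /-- the weights `π_j` -/
  weight : ι → ℝ
  /-- the matrices `ρ_j` -/
  state : ι → Matrix n n ℂ

namespace WeightedFamily

/-- The family is an ensemble: the weights form a strictly positive probability vector and each
`ρ_j` is a density matrix. -/
structure IsEnsemble {ι n : Type*} [Fintype ι] [Fintype n] (E : WeightedFamily ι n) : Prop where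
  weight_pos : ∀ j, 0 < E.weight j
  sum_weight : ∑ j, E.weight j = 1
  state_density : ∀ j, IsDensityMatrix (E.state j)

/-- `Φ(E)`: each `ρ_j` is replaced by `Φ(ρ_j)`. -/
def map {ι n m : Type*} (Φ : Matrix n n ℂ →ₗ[ℂ] Matrix m m ℂ) (E : WeightedFamily ι n) :
    WeightedFamily ι m where
  weight := E.weight
  state := fun j => Φ (E.state j)

/-- The Holevo quantity `χ(E) = S(∑ π_j ρ_j) - ∑ π_j S(ρ_j)`. -/
def holevoChi {ι n : Type*} [Fintype ι] [Fintype n] [DecidableEq n]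
    (E : WeightedFamily ι n) : ℝ :=
  vonNeumannEntropy (∑ j, (E.weight j : ℂ) • E.state j)
    - ∑ j, E.weight j * vonNeumannEntropy (E.state j)

end WeightedFamily

/-- A positive operator valued measurement `{M_a}` with outcomes `a : α`. -/
structure POVM (α n : Type*) [Fintype α] [Fintype n] [DecidableEq n] where
  /-- the operators `M_a` -/
  op : α → Matrix n n ℂ
  op_posSemidef : ∀ a, (op a).PosSemidef
  sum_op : ∑ a, op a = 1

/-- The measurement map `Φ_M : ρ ↦ ∑ a, (Tr ρ M_a) |a⟩⟨a|`. -/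
def POVM.measure {α n : Type*} [Fintype α] [DecidableEq α] [Fintype n] [DecidableEq n]
    (M : POVM α n) : Matrix n n ℂ →ₗ[ℂ] Matrix α α ℂ where
  toFun ρ := ∑ a, (ρ * M.op a).trace • Matrix.single a a (1 : ℂ)
  map_add' ρ σ := by
    simp only [Matrix.add_mul, Matrix.trace_add, add_smul, Finset.sum_add_distrib]
  map_smul' c ρ := by
    simp only [Matrix.smul_mul, Matrix.trace_smul, smul_assoc, Finset.smul_sum, RingHom.id_apply]

/-- The tensor product `Φ ⊗ Ψ` of linear maps of matrices, acting on matrices indexed by pairs,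
so that `(Φ ⊗ Ψ)(X ⊗ Y) = Φ(X) ⊗ Ψ(Y)` for Kronecker products. -/
def tensorMap {m m' n n' : Type*} [Fintype m] [DecidableEq m] [Fintype m'] [DecidableEq m']
    [Fintype n] [DecidableEq n] [Fintype n'] [DecidableEq n']
    (Φ : Matrix m m ℂ →ₗ[ℂ] Matrix m' m' ℂ) (Ψ : Matrix n n ℂ →ₗ[ℂ] Matrix n' n' ℂ) :
    Matrix (m × n) (m × n) ℂ →ₗ[ℂ] Matrix (m' × n') (m' × n') ℂ :=
  (kroneckerLinearEquiv m' m' n' n' ℂ).toLinearMap ∘ₗ TensorProduct.map Φ Ψ ∘ₗ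
    (kroneckerLinearEquiv m m n n ℂ).symm.toLinearMap

end

/-!
The Holevo quantity of an ensemble is the mean relative entropy of its states with respect to their
average `σ = ∑ π_k ρ_k`, that is `χ(E) = ∑ π_j D(ρ_j ‖ σ)`
(`WeightedFamily.holevoChi_eq_sum_relativeEntropy`). Both inequalities therefore follow from the
monotonicity of the relative entropy under maps with Kraus operators. The measurement map of a POVM
has Kraus operators `|a⟩⟨i| R_a`, where `M_a = R_aᴴ R_a`; Kraus families pass to tensor products of
maps; and `Φ_A ⊗ Φ_B` is `I ⊗ Φ_B` followed by `Φ_A ⊗ I`.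

Monotonicity of the relative entropy is proved by way of the quantities
`f_t(ρ, σ) = ⟨ρ, (L_σ + t R_ρ)⁻¹ ρ⟩` for `t > 0`, where `L_σ` and `R_ρ` are left and right
multiplication. By completing the square, `f_t(ρ, σ)` is the maximum over all matrices `X` of
`2 Re Tr(Xᴴ ρ) - Tr(Xᴴ σ X) - t Tr(X ρ Xᴴ)` (`resolventForm_le`, `exists_resolventForm_eq`). If `Y`
is a maximizer for `(Φ ρ, Φ σ)` and `Ψ` is the adjoint of `Φ`, the Kadison--Schwarz inequality
shows that `X = Ψ(Y)` gives at least as large a value for `(ρ, σ)`; hence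
`f_t(Φ ρ, Φ σ) ≤ f_t(ρ, σ)` (`IsKrausFamily.resolventQuasiEntropy_apply_le`).

Formally, `D(ρ ‖ σ) = ∫ f_t(ρ, σ) - Tr ρ / (1 + t) dt` over `t > 0`. Instead of an improper integral
the proof uses the explicit primitive `relativeEntropyPath`, which vanishes at `t = 0` and tends to
`D(ρ ‖ σ)` as `t → ∞`. The difference of the primitives for `(ρ, σ)` and `(Φ ρ, Φ σ)` has
nonnegative derivative, so its limit is nonnegative. Continuity at `t = 0` needs the kernel of `σ` to lie in
that of `ρ`, which holds for the states of an ensemble because `π_j ρ_j ≤ σ`.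
-/

open Matrix
open scoped Kronecker

/-! ### Spectral decompositions of two Hermitian matrices -/

section Spectral

variable {n : Type*} [Fintype n] [DecidableEq n] {ρ σ : Matrix n n ℂ}

/-- The matrix of inner products `⟨f_j, e_i⟩`, at row `j` and column `i`, between the chosen
orthonormal eigenbases `e` of `ρ` and `f` of `σ`. -/
noncomputable def Matrix.IsHermitian.overlap (hρ : ρ.IsHermitian) (hσ : σ.IsHermitian) :
    Matrix n n ℂ :=
  (hσ.eigenvectorUnitary : Matrix n n ℂ)ᴴ * (hρ.eigenvectorUnitary : Matrix n n ℂ)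

lemma eigenvectorUnitary_conjTranspose_mul_self (hρ : ρ.IsHermitian) :
    (hρ.eigenvectorUnitary : Matrix n n ℂ)ᴴ * (hρ.eigenvectorUnitary : Matrix n n ℂ) = 1 :=
  Unitary.coe_star_mul_self hρ.eigenvectorUnitary

lemma eigenvectorUnitary_mul_conjTranspose_self (hρ : ρ.IsHermitian) :
    (hρ.eigenvectorUnitary : Matrix n n ℂ) * (hρ.eigenvectorUnitary : Matrix n n ℂ)ᴴ = 1 :=
  Unitary.coe_mul_star_self hρ.eigenvectorUnitary

lemma cfc_eq_mul_diagonal_mul (hρ : ρ.IsHermitian) (f : ℝ → ℝ) :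
    cfc f ρ = (hρ.eigenvectorUnitary : Matrix n n ℂ) *
      diagonal (fun i => (f (hρ.eigenvalues i) : ℂ)) *
        (hρ.eigenvectorUnitary : Matrix n n ℂ)ᴴ := by
  rw [hρ.cfc_eq, Matrix.IsHermitian.cfc, Unitary.conjStarAlgAut_apply]
  rfl

lemma eq_mul_diagonal_mul (hρ : ρ.IsHermitian) :
    ρ = (hρ.eigenvectorUnitary : Matrix n n ℂ) *
      diagonal (fun i => (hρ.eigenvalues i : ℂ)) *
        (hρ.eigenvectorUnitary : Matrix n n ℂ)ᴴ := by
  conv_lhs => rw [hρ.spectral_theorem, Unitary.conjStarAlgAut_apply]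
  rfl

lemma re_trace_conjTranspose_mul_diagonal_mul (Y : Matrix n n ℂ) (q : n → ℝ) :
    (Yᴴ * diagonal (fun j => (q j : ℂ)) * Y).trace.re =
      ∑ i, ∑ j, q j * Complex.normSq (Y j i) := by
  simp only [trace, diag_apply, mul_apply (N := Y), mul_diagonal, Complex.re_sum,
    conjTranspose_apply]
  refine Finset.sum_congr rfl fun i _ => Finset.sum_congr rfl fun j _ => ?_
  simp [Complex.normSq_apply]
  ring

lemma sum_normSq_overlap (hρ : ρ.IsHermitian) (hσ : σ.IsHermitian) (i : n) :
    ∑ j, Complex.normSq (hρ.overlap hσ j i) = 1 := by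
  have h : (hρ.overlap hσ)ᴴ * hρ.overlap hσ = 1 := by
    simp only [IsHermitian.overlap, conjTranspose_mul, conjTranspose_conjTranspose]
    rw [Matrix.mul_assoc, ← Matrix.mul_assoc _ _ (hρ.eigenvectorUnitary : Matrix n n ℂ),
      eigenvectorUnitary_mul_conjTranspose_self, Matrix.one_mul,
      eigenvectorUnitary_conjTranspose_mul_self]
  have h2 := congrArg Complex.re (congrFun (congrFun h i) i)
  simp only [mul_apply, Complex.re_sum, conjTranspose_apply, one_apply_eq, Complex.one_re] at h2
  rw [← h2]
  refine Finset.sum_congr rfl fun j _ => ?_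
  simp [Complex.normSq_apply]

/-- Traces of products of functions of `ρ` and `σ` are expectations for the weights
`|⟨f_j, e_i⟩|²` on pairs of eigenvalues, which reduces relative entropies to scalar sums. -/
lemma re_trace_cfc_mul_cfc (hρ : ρ.IsHermitian) (hσ : σ.IsHermitian) (f g : ℝ → ℝ) :
    (cfc f ρ * cfc g σ).trace.re = ∑ i, ∑ j,
      Complex.normSq (hρ.overlap hσ j i) * (f (hρ.eigenvalues i) * g (hσ.eigenvalues j)) := by
  have h : (cfc f ρ * cfc g σ).trace =
      (diagonal (fun i => (f (hρ.eigenvalues i) : ℂ)) * (hρ.overlap hσ)ᴴ *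
        diagonal (fun i => (g (hσ.eigenvalues i) : ℂ)) * hρ.overlap hσ).trace := by
    rw [cfc_eq_mul_diagonal_mul hρ, cfc_eq_mul_diagonal_mul hσ, Matrix.mul_assoc,
      Matrix.mul_assoc, Matrix.trace_mul_comm]
    simp only [IsHermitian.overlap, conjTranspose_mul, conjTranspose_conjTranspose,
      Matrix.mul_assoc]
  rw [h]
  simp only [trace, diag_apply, mul_apply (N := hρ.overlap hσ), mul_diagonal, diagonal_mul,
    Complex.re_sum, conjTranspose_apply]
  refine Finset.sum_congr rfl fun i _ => Finset.sum_congr rfl fun j _ => ?_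
  simp [Complex.normSq_apply]
  ring

end Spectral

/-! ### A variational formula for the resolvent quasi-entropy -/

section Resolvent

variable {n : Type*} [Fintype n] [DecidableEq n] {ρ σ : Matrix n n ℂ}

/-- The quadratic form `X ↦ 2 Re Tr(Xᴴ ρ) - Tr(Xᴴ σ X) - t Tr(X ρ Xᴴ)`; its maximum over `X` is
`⟨ρ, (L_σ + t R_ρ)⁻¹ ρ⟩`, with `L_σ` and `R_ρ` the left and right multiplications. Taking the real
part of each trace makes it real-valued for arbitrary `ρ` and `σ`. -/
noncomputable def resolventForm (ρ σ : Matrix n n ℂ) (t : ℝ) (X : Matrix n n ℂ) : ℝ :=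
  2 * (Xᴴ * ρ).trace.re - (Xᴴ * σ * X).trace.re - t * (X * ρ * Xᴴ).trace.re

/-- The quantity `⟨ρ, (L_σ + t R_ρ)⁻¹ ρ⟩`, written in the eigenbases of `ρ` and `σ`. For positive
semidefinite matrices and `t > 0` a denominator vanishes only along with the eigenvalue of `ρ` in
its numerator, so the convention `0 / 0 = 0` gives the correct value. -/
noncomputable def resolventQuasiEntropy (hρ : ρ.IsHermitian) (hσ : σ.IsHermitian) (t : ℝ) : ℝ :=
  ∑ i, ∑ j, Complex.normSq (hρ.overlap hσ j i) *
    (hρ.eigenvalues i ^ 2 / (hσ.eigenvalues j + t * hρ.eigenvalues i))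

/-- In the eigenbases of `ρ` and `σ` the form `resolventForm` decouples into one scalar quadratic
form for each matrix entry. -/
lemma resolventForm_conj (hρ : ρ.IsHermitian) (hσ : σ.IsHermitian) (t : ℝ) (Y : Matrix n n ℂ) :
    resolventForm ρ σ t ((hσ.eigenvectorUnitary : Matrix n n ℂ) * Y *
        (hρ.eigenvectorUnitary : Matrix n n ℂ)ᴴ) =
      ∑ i, ∑ j, (2 * hρ.eigenvalues i * (star (Y j i) * hρ.overlap hσ j i).re -
        (hσ.eigenvalues j + t * hρ.eigenvalues i) * Complex.normSq (Y j i)) := by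
  have e1 := eigenvectorUnitary_conjTranspose_mul_self hρ
  have e2 := eigenvectorUnitary_conjTranspose_mul_self hσ
  have d1 := eq_mul_diagonal_mul hρ
  have d2 := eq_mul_diagonal_mul hσ
  set U : Matrix n n ℂ := (hρ.eigenvectorUnitary : Matrix n n ℂ) with hU
  set V : Matrix n n ℂ := (hσ.eigenvectorUnitary : Matrix n n ℂ) with hV
  set D : Matrix n n ℂ := diagonal (fun i => (hρ.eigenvalues i : ℂ)) with hD
  set C : Matrix n n ℂ := diagonal (fun i => (hσ.eigenvalues i : ℂ)) with hC
  have a1 : ((V * Y * Uᴴ)ᴴ * ρ).trace = (Yᴴ * hρ.overlap hσ * D).trace := by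
    have : (V * Y * Uᴴ)ᴴ * ρ = U * (Yᴴ * (Vᴴ * U) * D * Uᴴ) := by
      rw [d1]
      simp only [conjTranspose_mul, conjTranspose_conjTranspose, Matrix.mul_assoc]
    rw [this, Matrix.trace_mul_comm, Matrix.mul_assoc _ Uᴴ U, e1, Matrix.mul_one]
    rfl
  have a2 : ((V * Y * Uᴴ)ᴴ * σ * (V * Y * Uᴴ)).trace = (Yᴴ * C * Y).trace := by
    have : (V * Y * Uᴴ)ᴴ * σ * (V * Y * Uᴴ) =
        U * (Yᴴ * (Vᴴ * V) * C * (Vᴴ * V) * Y * Uᴴ) := by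
      rw [d2]
      simp only [conjTranspose_mul, conjTranspose_conjTranspose, Matrix.mul_assoc]
    rw [this, Matrix.trace_mul_comm, Matrix.mul_assoc _ Uᴴ U, e1, e2]
    simp only [Matrix.mul_one]
  have a3 : ((V * Y * Uᴴ) * ρ * (V * Y * Uᴴ)ᴴ).trace = (Y * D * Yᴴ).trace := by
    have : (V * Y * Uᴴ) * ρ * (V * Y * Uᴴ)ᴴ =
        V * (Y * (Uᴴ * U) * D * (Uᴴ * U) * Yᴴ * Vᴴ) := by
      rw [d1]
      simp only [conjTranspose_mul, conjTranspose_conjTranspose, Matrix.mul_assoc]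
    rw [this, Matrix.trace_mul_comm, Matrix.mul_assoc _ Vᴴ V, e1, e2]
    simp only [Matrix.mul_one]
  have b3 : (Y * D * Yᴴ).trace.re = ∑ i, ∑ j, hρ.eigenvalues i * Complex.normSq (Y j i) := by
    have := re_trace_conjTranspose_mul_diagonal_mul Yᴴ hρ.eigenvalues
    rw [conjTranspose_conjTranspose] at this
    rw [hD, this, Finset.sum_comm]
    simp [Complex.normSq_conj]
  have b1 : (Yᴴ * hρ.overlap hσ * D).trace.re =
      ∑ i, ∑ j, hρ.eigenvalues i * (star (Y j i) * hρ.overlap hσ j i).re := by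
    simp only [hD, trace, diag_apply, mul_diagonal, Complex.re_sum,
      mul_apply (N := hρ.overlap hσ), conjTranspose_apply, Complex.re_mul_ofReal, Finset.sum_mul]
    exact Finset.sum_congr rfl fun i _ => Finset.sum_congr rfl fun j _ => mul_comm _ _
  rw [resolventForm, a1, a2, a3, b1, b3, hC, re_trace_conjTranspose_mul_diagonal_mul]
  simp only [Finset.mul_sum, ← Finset.sum_sub_distrib]
  exact Finset.sum_congr rfl fun i _ => Finset.sum_congr rfl fun j _ => by ring

lemma resolventForm_le (hρ : ρ.PosSemidef) (hσ : σ.PosSemidef) {t : ℝ} (ht : 0 < t)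
    (X : Matrix n n ℂ) :
    resolventForm ρ σ t X ≤ resolventQuasiEntropy hρ.1 hσ.1 t := by
  have hX : X = (hσ.1.eigenvectorUnitary : Matrix n n ℂ) *
      ((hσ.1.eigenvectorUnitary : Matrix n n ℂ)ᴴ * X *
        (hρ.1.eigenvectorUnitary : Matrix n n ℂ)) *
        (hρ.1.eigenvectorUnitary : Matrix n n ℂ)ᴴ := by
    rw [← Matrix.mul_assoc, ← Matrix.mul_assoc, eigenvectorUnitary_mul_conjTranspose_self,
      Matrix.one_mul, Matrix.mul_assoc, eigenvectorUnitary_mul_conjTranspose_self, Matrix.mul_one]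
  rw [hX, resolventForm_conj hρ.1 hσ.1, resolventQuasiEntropy]
  refine Finset.sum_le_sum fun i _ => Finset.sum_le_sum fun j _ => ?_
  generalize ((hσ.1.eigenvectorUnitary : Matrix n n ℂ)ᴴ * X *
        (hρ.1.eigenvectorUnitary : Matrix n n ℂ)) j i = y
  generalize hρ.1.overlap hσ.1 j i = u
  have hp := hρ.eigenvalues_nonneg i
  have hq := hσ.eigenvalues_nonneg j
  generalize hρ.1.eigenvalues i = p at *
  generalize hσ.1.eigenvalues j = q at *
  rcases hp.eq_or_lt with rfl | hp
  · simpa using mul_nonneg hq (Complex.normSq_nonneg y)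
  · have hd : 0 < q + t * p := by positivity
    rw [← mul_div_assoc, le_div_iff₀ hd]
    simp only [Complex.normSq_apply, Complex.mul_re, Complex.star_def, Complex.conj_re,
      Complex.conj_im]
    generalize q + t * p = d at *
    -- Completing the square: the difference of the two sides is `|d y - p u|²`.
    nlinarith [sq_nonneg (d * y.re - p * u.re), sq_nonneg (d * y.im - p * u.im)]

lemma exists_resolventForm_eq (hρ : ρ.PosSemidef) (hσ : σ.PosSemidef) {t : ℝ} (ht : 0 < t) :
    ∃ X, resolventForm ρ σ t X = resolventQuasiEntropy hρ.1 hσ.1 t := by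
  -- The maximizer has entries `p_i u_ji / (q_j + t p_i)` in the eigenbases.
  refine ⟨_, (resolventForm_conj hρ.1 hσ.1 t (of fun j i =>
    ((hρ.1.eigenvalues i / (hσ.1.eigenvalues j + t * hρ.1.eigenvalues i) : ℝ) : ℂ) *
      hρ.1.overlap hσ.1 j i)).trans ?_⟩
  refine Finset.sum_congr rfl fun i _ => Finset.sum_congr rfl fun j _ => ?_
  rw [of_apply]
  generalize hρ.1.overlap hσ.1 j i = u
  have hp := hρ.eigenvalues_nonneg i
  have hq := hσ.eigenvalues_nonneg j
  generalize hρ.1.eigenvalues i = p at *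
  generalize hσ.1.eigenvalues j = q at *
  rcases hp.eq_or_lt with rfl | hp
  · simp
  · have hd : 0 < q + t * p := by positivity
    simp only [Complex.normSq_apply, Complex.mul_re, Complex.mul_im, Complex.star_def,
      Complex.conj_re, Complex.conj_im, Complex.ofReal_re, Complex.ofReal_im]
    generalize q + t * p = d at *
    field_simp
    ring

end Resolvent

/-! ### Kraus families and monotonicity of the resolvent quasi-entropy -/

section Kraus

variable {κ n m : Type*} [Fintype κ]

/-- The operators `K_k` form a Kraus family of `Φ`: `Φ(X) = ∑ K_k X K_kᴴ` and `∑ K_kᴴ K_k = 1`, so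
that `Φ` is completely positive and trace preserving. -/
structure IsKrausFamily [Fintype n] [DecidableEq n] [Fintype m] (K : κ → Matrix m n ℂ)
    (Φ : Matrix n n ℂ →ₗ[ℂ] Matrix m m ℂ) : Prop where
  sum_conjTranspose_mul_self : ∑ k, (K k)ᴴ * K k = 1
  apply_eq : ∀ X, Φ X = ∑ k, K k * X * (K k)ᴴ

/-- The adjoint map `Y ↦ ∑ K_kᴴ Y K_k`, for the trace pairing, of the map with Kraus family `K`. -/
def krausDual [Fintype m] (K : κ → Matrix m n ℂ) (Y : Matrix m m ℂ) : Matrix n n ℂ :=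
  ∑ k, (K k)ᴴ * Y * K k

lemma krausDual_conjTranspose [Fintype m] (K : κ → Matrix m n ℂ) (Y : Matrix m m ℂ) :
    krausDual K Yᴴ = (krausDual K Y)ᴴ := by
  simp [krausDual, conjTranspose_sum, Matrix.mul_assoc]

namespace IsKrausFamily

variable [Fintype n] [DecidableEq n] [Fintype m] {K : κ → Matrix m n ℂ}
  {Φ : Matrix n n ℂ →ₗ[ℂ] Matrix m m ℂ}

lemma trace_mul_apply (h : IsKrausFamily K Φ) (Y : Matrix m m ℂ) (X : Matrix n n ℂ) :
    (Y * Φ X).trace = (krausDual K Y * X).trace := by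
  rw [h.apply_eq, krausDual, Matrix.mul_sum, Matrix.sum_mul, trace_sum, trace_sum]
  refine Finset.sum_congr rfl fun k _ => ?_
  rw [← Matrix.mul_assoc, Matrix.trace_mul_comm]
  simp only [Matrix.mul_assoc]

lemma trace_apply (h : IsKrausFamily K Φ) (X : Matrix n n ℂ) : (Φ X).trace = X.trace := by
  classical
  have := h.trace_mul_apply 1 X
  simpa [krausDual, h.sum_conjTranspose_mul_self] using this

lemma posSemidef_apply (h : IsKrausFamily K Φ) {X : Matrix n n ℂ} (hX : X.PosSemidef) :
    (Φ X).PosSemidef := by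
  rw [h.apply_eq]
  exact posSemidef_sum _ fun k _ => hX.mul_mul_conjTranspose_same (K k)

/-- The Kadison--Schwarz inequality `Ψ(Y)ᴴ Ψ(Y) ≤ Ψ(Yᴴ Y)` for the adjoint `Ψ` of `Φ`, paired
with `ρ`. -/
lemma re_trace_krausDual_le (h : IsKrausFamily K Φ) {ρ : Matrix n n ℂ} (hρ : ρ.PosSemidef)
    (Y : Matrix m m ℂ) :
    (krausDual K Y * ρ * (krausDual K Y)ᴴ).trace.re ≤ (Y * Φ ρ * Yᴴ).trace.re := by
  set Z := krausDual K Y with hZ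
  -- `Ψ(Yᴴ Y) - Zᴴ Z` is the sum of the squares `(Y K_k - K_k Z)ᴴ (Y K_k - K_k Z)`.
  have key : ∑ k, ((Y * K k - K k * Z) * ρ * (Y * K k - K k * Z)ᴴ).trace =
      (Y * Φ ρ * Yᴴ).trace - (Z * ρ * Zᴴ).trace := by
    have e (k : κ) : ((Y * K k - K k * Z) * ρ * (Y * K k - K k * Z)ᴴ).trace =
        (Y * (K k * ρ * (K k)ᴴ) * Yᴴ).trace - (((K k)ᴴ * Y * K k) * (ρ * Zᴴ)).trace -
          (Z * ρ * ((K k)ᴴ * Yᴴ * K k)).trace + (((K k)ᴴ * K k) * (Z * ρ * Zᴴ)).trace := by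
      have e1 : (((K k)ᴴ * Y * K k) * (ρ * Zᴴ)).trace = (Y * K k * ρ * Zᴴ * (K k)ᴴ).trace := by
        rw [Matrix.trace_mul_comm _ (K k)ᴴ]
        simp only [Matrix.mul_assoc]
      have e2 : (Z * ρ * ((K k)ᴴ * Yᴴ * K k)).trace = (K k * Z * ρ * (K k)ᴴ * Yᴴ).trace := by
        rw [← Matrix.mul_assoc, Matrix.trace_mul_comm]
        simp only [Matrix.mul_assoc]
      have e3 : (((K k)ᴴ * K k) * (Z * ρ * Zᴴ)).trace = (K k * Z * ρ * Zᴴ * (K k)ᴴ).trace := by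
        rw [Matrix.trace_mul_comm _ (K k)ᴴ]
        simp only [Matrix.mul_assoc]
      rw [e1, e2, e3, ← trace_sub, ← trace_sub, ← trace_add]
      simp only [conjTranspose_sub, conjTranspose_mul, Matrix.sub_mul, Matrix.mul_sub,
        Matrix.mul_assoc]
      congr 1
      abel
    have hZ' : ∑ k, (K k)ᴴ * Yᴴ * K k = Zᴴ := (krausDual_conjTranspose K Y).symm ▸ rfl
    simp only [e, Finset.sum_add_distrib, Finset.sum_sub_distrib, ← trace_sum, ← Matrix.sum_mul,
      ← Matrix.mul_sum, ← h.apply_eq, h.sum_conjTranspose_mul_self, hZ', Matrix.one_mul]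
    rw [show ∑ k, (K k)ᴴ * Y * K k = Z from rfl, ← Matrix.mul_assoc Z]
    ring
  have hnn : 0 ≤ (∑ k, ((Y * K k - K k * Z) * ρ * (Y * K k - K k * Z)ᴴ).trace).re := by
    rw [Complex.re_sum]
    exact Finset.sum_nonneg fun k _ =>
      (Complex.le_def.1 (hρ.mul_mul_conjTranspose_same (Y * K k - K k * Z)).trace_nonneg).1
  rw [key, Complex.sub_re] at hnn
  linarith

lemma resolventForm_apply_le (h : IsKrausFamily K Φ) {ρ σ : Matrix n n ℂ} (hρ : ρ.PosSemidef)
    (hσ : σ.PosSemidef) {t : ℝ} (ht : 0 < t) (Y : Matrix m m ℂ) :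
    resolventForm (Φ ρ) (Φ σ) t Y ≤ resolventForm ρ σ t (krausDual K Y) := by
  have h1 : (Yᴴ * Φ ρ).trace = ((krausDual K Y)ᴴ * ρ).trace := by
    rw [h.trace_mul_apply, krausDual_conjTranspose]
  have h2 := h.re_trace_krausDual_le hσ Yᴴ
  rw [krausDual_conjTranspose, conjTranspose_conjTranspose, conjTranspose_conjTranspose] at h2
  have h3 := mul_le_mul_of_nonneg_left (h.re_trace_krausDual_le hρ Y) ht.le
  rw [resolventForm, resolventForm, h1]
  linarith

lemma resolventQuasiEntropy_apply_le [DecidableEq m] (h : IsKrausFamily K Φ) {ρ σ : Matrix n n ℂ}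
    (hρ : ρ.PosSemidef) (hσ : σ.PosSemidef) {t : ℝ} (ht : 0 < t) :
    resolventQuasiEntropy (h.posSemidef_apply hρ).1 (h.posSemidef_apply hσ).1 t ≤
      resolventQuasiEntropy hρ.1 hσ.1 t := by
  obtain ⟨Y, hY⟩ := exists_resolventForm_eq (h.posSemidef_apply hρ) (h.posSemidef_apply hσ) ht
  rw [← hY]
  exact (h.resolventForm_apply_le hρ hσ ht Y).trans (resolventForm_le hρ hσ ht _)

end IsKrausFamily

end Kraus

/-! ### Monotonicity of the relative entropy -/

section RelativeEntropy

variable {n : Type*} [Fintype n] [DecidableEq n] {ρ σ : Matrix n n ℂ}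

/-- The relative entropy `Tr ρ (log ρ - log σ)`. As `Real.log 0 = 0`, it agrees with the usual
notion only when the kernel of `σ` is contained in that of `ρ`. -/
noncomputable def relativeEntropy (ρ σ : Matrix n n ℂ) : ℝ :=
  (ρ * cfc Real.log ρ).trace.re - (ρ * cfc Real.log σ).trace.re

lemma relativeEntropy_eq_sum (hρ : ρ.IsHermitian) (hσ : σ.IsHermitian) :
    relativeEntropy ρ σ = ∑ i, ∑ j, Complex.normSq (hρ.overlap hσ j i) *
      (hρ.eigenvalues i * (Real.log (hρ.eigenvalues i) - Real.log (hσ.eigenvalues j))) := by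
  have h1 : (ρ * cfc Real.log ρ).trace.re = ∑ i, ∑ j, Complex.normSq (hρ.overlap hσ j i) *
      (hρ.eigenvalues i * Real.log (hρ.eigenvalues i)) := by
    have h := re_trace_cfc_mul_cfc hρ hσ (fun x => x * Real.log x) (fun _ => 1)
    have hm : cfc (fun x => x * Real.log x) ρ = ρ * cfc Real.log ρ := by
      rw [cfc_mul (fun x => x) Real.log ρ (by fun_prop)
        (ρ.finite_real_spectrum.continuousOn _), cfc_id' ℝ ρ]
    have h1 : cfc (fun _ : ℝ => (1 : ℝ)) σ = 1 := cfc_const_one ℝ σ (ha := hσ)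
    simpa only [hm, h1, Matrix.mul_one, mul_one] using h
  have h2 := re_trace_cfc_mul_cfc hρ hσ (fun x => x) Real.log
  rw [cfc_id' ℝ ρ] at h2
  rw [relativeEntropy, h1, h2]
  simp only [← Finset.sum_sub_distrib]
  exact Finset.sum_congr rfl fun i _ => Finset.sum_congr rfl fun j _ => by ring

/-- A function of `t` going from `0` at `t = 0` to the relative entropy as `t → ∞`, whose
derivative is `resolventQuasiEntropy` up to the term `Tr ρ / (1 + t)`. It is the integral
`∫ ⟨ρ, (L_σ + s R_ρ)⁻¹ ρ⟩ - Tr ρ / (1 + s) ds` over `[0, t]`, evaluated in eigenbases, when the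
kernel of `σ` is contained in that of `ρ`. -/
noncomputable def relativeEntropyPath (hρ : ρ.IsHermitian) (hσ : σ.IsHermitian) (t : ℝ) : ℝ :=
  ∑ i, ∑ j, Complex.normSq (hρ.overlap hσ j i) * (hρ.eigenvalues i *
    (Real.log (hσ.eigenvalues j + t * hρ.eigenvalues i) - Real.log (hσ.eigenvalues j) -
      Real.log (1 + t)))

lemma relativeEntropyPath_zero (hρ : ρ.IsHermitian) (hσ : σ.IsHermitian) :
    relativeEntropyPath hρ hσ 0 = 0 := by
  simp [relativeEntropyPath]

lemma hasDerivAt_relativeEntropyPath (hρ : ρ.PosSemidef) (hσ : σ.PosSemidef) {t : ℝ}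
    (ht : 0 < t) :
    HasDerivAt (relativeEntropyPath hρ.1 hσ.1)
      (resolventQuasiEntropy hρ.1 hσ.1 t - ρ.trace.re / (1 + t)) t := by
  have htr : ρ.trace.re / (1 + t) = ∑ i, ∑ j, Complex.normSq (hρ.1.overlap hσ.1 j i) *
      (hρ.1.eigenvalues i / (1 + t)) := by
    simp only [← Finset.sum_mul, sum_normSq_overlap, one_mul]
    rw [hρ.1.trace_eq_sum_eigenvalues, ← Finset.sum_div]
    simp
  rw [htr, resolventQuasiEntropy]
  simp only [← Finset.sum_sub_distrib, ← mul_sub]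
  refine HasDerivAt.fun_sum fun i _ => HasDerivAt.fun_sum fun j _ => HasDerivAt.const_mul _ ?_
  have hp := hρ.eigenvalues_nonneg i
  have hq := hσ.eigenvalues_nonneg j
  generalize hρ.1.eigenvalues i = p at *
  generalize hσ.1.eigenvalues j = q at *
  rcases hp.eq_or_lt with rfl | hp
  · simpa using hasDerivAt_const t (0 : ℝ)
  · have hd : q + t * p ≠ 0 := by positivity
    have h1 : HasDerivAt (fun t : ℝ => q + t * p) p t := by
      simpa using ((hasDerivAt_id t).mul_const p).const_add q
    have h2 : HasDerivAt (fun t : ℝ => 1 + t) 1 t := (hasDerivAt_id t).const_add 1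
    refine ((((h1.log hd).sub_const (Real.log q)).fun_sub
      (h2.log (by positivity))).const_mul p).congr_deriv ?_
    field_simp

lemma tendsto_relativeEntropyPath (hρ : ρ.PosSemidef) (hσ : σ.PosSemidef) :
    Filter.Tendsto (relativeEntropyPath hρ.1 hσ.1) Filter.atTop
      (nhds (relativeEntropy ρ σ)) := by
  rw [relativeEntropy_eq_sum hρ.1 hσ.1]
  refine tendsto_finsetSum _ fun i _ => tendsto_finsetSum _ fun j _ =>
    Filter.Tendsto.const_mul _ ?_
  have hp := hρ.eigenvalues_nonneg i
  have hq := hσ.eigenvalues_nonneg j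
  generalize hρ.1.eigenvalues i = p at *
  generalize hσ.1.eigenvalues j = q at *
  rcases hp.eq_or_lt with rfl | hp
  · simp
  refine Filter.Tendsto.const_mul _ ?_
  -- `(q + t p) / (1 + t) = p + (q - p) / (1 + t)` tends to `p`.
  have h1 : Filter.Tendsto (fun t : ℝ => p + (q - p) * (1 + t)⁻¹) Filter.atTop (nhds p) := by
    have := (tendsto_inv_atTop_zero.comp
      (Filter.tendsto_atTop_add_const_left Filter.atTop (1 : ℝ) Filter.tendsto_id)).const_mul
        (q - p)
    simpa using this.const_add p
  refine ((h1.log hp.ne').sub_const (Real.log q)).congr' ?_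
  filter_upwards [Filter.eventually_gt_atTop 0] with t ht
  have hd : q + t * p ≠ 0 := by positivity
  have h1t : (1 + t) ≠ 0 := by positivity
  rw [show p + (q - p) * (1 + t)⁻¹ = (q + t * p) / (1 + t) by field_simp; ring,
    Real.log_div hd h1t]
  ring

/-- If `c ρ ≤ σ` with `c > 0`, the kernel of `σ` is contained in that of `ρ`: no eigenvector of `ρ`
with a nonzero eigenvalue overlaps the kernel of `σ`. -/
lemma normSq_overlap_mul_eigenvalue_eq_zero (hρ : ρ.PosSemidef) (hσ : σ.PosSemidef) {c : ℝ}
    (hc : 0 < c) (hle : (σ - (c : ℂ) • ρ).PosSemidef) (i : n) {j : n}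
    (hj : hσ.1.eigenvalues j = 0) :
    Complex.normSq (hρ.1.overlap hσ.1 j i) * hρ.1.eigenvalues i = 0 := by
  set U : Matrix n n ℂ := (hρ.1.eigenvectorUnitary : Matrix n n ℂ) with hU
  set V : Matrix n n ℂ := (hσ.1.eigenvectorUnitary : Matrix n n ℂ) with hV
  have hV1 : Vᴴ * V = 1 := eigenvectorUnitary_conjTranspose_mul_self hσ.1
  have e1 : Vᴴ * σ * V = diagonal (fun j => (hσ.1.eigenvalues j : ℂ)) := by
    have : Vᴴ * σ * V = (Vᴴ * V) * diagonal (fun j => (hσ.1.eigenvalues j : ℂ)) * (Vᴴ * V) := by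
      conv_lhs => rw [eq_mul_diagonal_mul hσ.1]
      simp only [← hV, Matrix.mul_assoc]
    rw [this, hV1, Matrix.one_mul, Matrix.mul_one]
  have e2 : Vᴴ * ρ * V = hρ.1.overlap hσ.1 * diagonal (fun j => (hρ.1.eigenvalues j : ℂ)) *
      (hρ.1.overlap hσ.1)ᴴ := by
    conv_lhs => rw [eq_mul_diagonal_mul hρ.1]
    simp only [IsHermitian.overlap, conjTranspose_mul, conjTranspose_conjTranspose,
      Matrix.mul_assoc, ← hU, ← hV]
  have e3 : (Vᴴ * ρ * V) j j =
      ((∑ i, Complex.normSq (hρ.1.overlap hσ.1 j i) * hρ.1.eigenvalues i : ℝ) : ℂ) := by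
    rw [e2, mul_apply]
    push_cast
    refine Finset.sum_congr rfl fun k _ => ?_
    rw [mul_diagonal, conjTranspose_apply, mul_right_comm]
    exact congrArg (· * (hρ.1.eigenvalues k : ℂ)) (Complex.mul_conj _)
  have h := (hle.conjTranspose_mul_mul_same V).diag_nonneg (i := j)
  rw [Matrix.mul_sub, Matrix.sub_mul, Matrix.mul_smul, Matrix.smul_mul, Matrix.sub_apply,
    Matrix.smul_apply, e1, e3, diagonal_apply_eq, hj, smul_eq_mul, ← Complex.ofReal_mul,
    ← Complex.ofReal_sub, Complex.zero_le_real] at h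
  have hnn : ∀ i ∈ Finset.univ,
      0 ≤ Complex.normSq (hρ.1.overlap hσ.1 j i) * hρ.1.eigenvalues i := fun i _ =>
    mul_nonneg (Complex.normSq_nonneg _) (hρ.eigenvalues_nonneg i)
  have hz : ∑ i, Complex.normSq (hρ.1.overlap hσ.1 j i) * hρ.1.eigenvalues i = 0 :=
    le_antisymm (by nlinarith) (Finset.sum_nonneg hnn)
  exact (Finset.sum_eq_zero_iff_of_nonneg hnn).1 hz i (Finset.mem_univ i)

/-- The bound `c ρ ≤ σ` is what gives continuity at `t = 0`: a term with `q = 0` and `p > 0`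
contains `log (t p)`, and has to carry weight zero. -/
lemma continuousOn_relativeEntropyPath (hρ : ρ.PosSemidef) (hσ : σ.PosSemidef) {c : ℝ}
    (hc : 0 < c) (hle : (σ - (c : ℂ) • ρ).PosSemidef) :
    ContinuousOn (relativeEntropyPath hρ.1 hσ.1) (Set.Ici 0) := by
  refine continuousOn_finsetSum _ fun i _ => continuousOn_finsetSum _ fun j _ => ?_
  have hw := normSq_overlap_mul_eigenvalue_eq_zero hρ hσ hc hle i (j := j)
  have hp := hρ.eigenvalues_nonneg i
  have hq := hσ.eigenvalues_nonneg j
  simp only [← mul_assoc]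
  generalize hρ.1.eigenvalues i = p at *
  generalize hσ.1.eigenvalues j = q at *
  rcases hq.eq_or_lt with rfl | hq
  · simp only [hw rfl, zero_mul]
    exact continuousOn_const
  · refine continuousOn_const.mul ((ContinuousOn.sub (ContinuousOn.log (by fun_prop) ?_)
      continuousOn_const).sub (ContinuousOn.log (by fun_prop) ?_))
    · intro t ht
      have : 0 ≤ t := ht
      positivity
    · intro t ht
      have : 0 ≤ t := ht
      positivity

/-- The data processing inequality for the relative entropy, for `ρ` dominated by a multiple of
`σ`. -/
theorem IsKrausFamily.relativeEntropy_apply_le {κ m : Type*} [Fintype κ] [Fintype m]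
    [DecidableEq m] {K : κ → Matrix m n ℂ} {Φ : Matrix n n ℂ →ₗ[ℂ] Matrix m m ℂ}
    (h : IsKrausFamily K Φ) (hρ : ρ.PosSemidef) (hσ : σ.PosSemidef) {c : ℝ} (hc : 0 < c)
    (hle : (σ - (c : ℂ) • ρ).PosSemidef) :
    relativeEntropy (Φ ρ) (Φ σ) ≤ relativeEntropy ρ σ := by
  have hρ' := h.posSemidef_apply hρ
  have hσ' := h.posSemidef_apply hσ
  have hle' : (Φ σ - (c : ℂ) • Φ ρ).PosSemidef := by
    simpa using h.posSemidef_apply hle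
  -- The terms `Tr ρ / (1 + t)` cancel in the derivative of `H`, since `Φ` preserves the trace.
  set H : ℝ → ℝ := fun t =>
    relativeEntropyPath hρ.1 hσ.1 t - relativeEntropyPath hρ'.1 hσ'.1 t with hH
  have hmono : MonotoneOn H (Set.Ici 0) := by
    refine monotoneOn_of_hasDerivWithinAt_nonneg (convex_Ici 0)
      ((continuousOn_relativeEntropyPath hρ hσ hc hle).sub
        (continuousOn_relativeEntropyPath hρ' hσ' hc hle'))
      (f' := fun t => (resolventQuasiEntropy hρ.1 hσ.1 t - ρ.trace.re / (1 + t)) -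
        (resolventQuasiEntropy hρ'.1 hσ'.1 t - (Φ ρ).trace.re / (1 + t)))
      (fun t ht => ?_) (fun t ht => ?_)
    · rw [interior_Ici] at ht
      exact ((hasDerivAt_relativeEntropyPath hρ hσ ht).sub
        (hasDerivAt_relativeEntropyPath hρ' hσ' ht)).hasDerivWithinAt
    · rw [interior_Ici] at ht
      have := h.resolventQuasiEntropy_apply_le hρ hσ ht
      rw [h.trace_apply]
      linarith
  have hlim : Filter.Tendsto H Filter.atTop
      (nhds (relativeEntropy ρ σ - relativeEntropy (Φ ρ) (Φ σ))) :=
    (tendsto_relativeEntropyPath hρ hσ).sub (tendsto_relativeEntropyPath hρ' hσ')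
  have h0 : H 0 = 0 := by simp [hH, relativeEntropyPath_zero]
  have : 0 ≤ relativeEntropy ρ σ - relativeEntropy (Φ ρ) (Φ σ) := by
    refine ge_of_tendsto hlim ?_
    filter_upwards [Filter.eventually_ge_atTop 0] with t ht
    rw [← h0]
    exact hmono Set.self_mem_Ici ht ht
  linarith

end RelativeEntropy

/-! ### Monotonicity of the Holevo quantity -/

section Holevo

lemma WeightedFamily.map_comp {ι n m l : Type*} (Ψ : Matrix m m ℂ →ₗ[ℂ] Matrix l l ℂ)
    (Φ : Matrix n n ℂ →ₗ[ℂ] Matrix m m ℂ) (E : WeightedFamily ι n) :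
    E.map (Ψ ∘ₗ Φ) = (E.map Φ).map Ψ := rfl

lemma WeightedFamily.holevoChi_eq_sum_relativeEntropy {ι n : Type*} [Fintype ι] [Fintype n]
    [DecidableEq n] (E : WeightedFamily ι n) :
    E.holevoChi = ∑ j, E.weight j *
      relativeEntropy (E.state j) (∑ k, (E.weight k : ℂ) • E.state k) := by
  set σ := ∑ k, (E.weight k : ℂ) • E.state k with hσ
  have h : (σ * cfc Real.log σ).trace.re =
      ∑ j, E.weight j * (E.state j * cfc Real.log σ).trace.re := by
    conv_lhs => rw [hσ, ← hσ]
    simp [hσ, Matrix.sum_mul, trace_sum, Complex.re_sum]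
  simp only [WeightedFamily.holevoChi, ← hσ, vonNeumannEntropy, relativeEntropy, h, mul_sub,
    mul_neg, Finset.sum_neg_distrib, Finset.sum_sub_distrib]
  ring

variable {ι n m : Type*} [Fintype ι] [Fintype n] [DecidableEq n] [Fintype m]

lemma WeightedFamily.IsEnsemble.map_kraus {κ : Type*} [Fintype κ] {E : WeightedFamily ι n}
    (hE : E.IsEnsemble) {K : κ → Matrix m n ℂ} {Φ : Matrix n n ℂ →ₗ[ℂ] Matrix m m ℂ}
    (h : IsKrausFamily K Φ) : (E.map Φ).IsEnsemble where
  weight_pos := hE.weight_pos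
  sum_weight := hE.sum_weight
  state_density j := ⟨h.posSemidef_apply (hE.state_density j).1,
    (h.trace_apply _).trans (hE.state_density j).2⟩

/-- The Holevo quantity does not increase under a channel: it is the mean relative entropy of the
states with respect to their average, and the average dominates `π_j ρ_j`. -/
theorem WeightedFamily.IsEnsemble.holevoChi_map_le [DecidableEq m] {κ : Type*} [Fintype κ]
    {E : WeightedFamily ι n} (hE : E.IsEnsemble) {K : κ → Matrix m n ℂ}
    {Φ : Matrix n n ℂ →ₗ[ℂ] Matrix m m ℂ} (h : IsKrausFamily K Φ) :
    (E.map Φ).holevoChi ≤ E.holevoChi := by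
  classical
  have hpos (j : ι) : ((E.weight j : ℂ) • E.state j).PosSemidef :=
    (hE.state_density j).1.smul (Complex.zero_le_real.2 (hE.weight_pos j).le)
  rw [holevoChi_eq_sum_relativeEntropy, holevoChi_eq_sum_relativeEntropy]
  refine Finset.sum_le_sum fun j _ => mul_le_mul_of_nonneg_left ?_ (hE.weight_pos j).le
  have hmap : ∑ k, ((E.map Φ).weight k : ℂ) • (E.map Φ).state k =
      Φ (∑ k, (E.weight k : ℂ) • E.state k) := by
    simp [WeightedFamily.map]
  rw [hmap]
  refine h.relativeEntropy_apply_le (hE.state_density j).1 (posSemidef_sum _ fun k _ => hpos k)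
    (hE.weight_pos j) ?_
  -- `∑ π_k ρ_k - π_j ρ_j` is the sum over the indices other than `j`.
  rw [← Finset.sum_erase_eq_sub (Finset.mem_univ j)]
  exact posSemidef_sum _ fun k _ => hpos k

end Holevo

/-! ### Kraus families of measurements and of tensor products -/

section Channels

lemma isKrausFamily_id {n : Type*} [Fintype n] [DecidableEq n] :
    IsKrausFamily (fun _ : Unit => (1 : Matrix n n ℂ)) LinearMap.id where
  sum_conjTranspose_mul_self := by simp
  apply_eq X := by simp

/-- With `M_a = R_aᴴ R_a`, the operators `|a⟩⟨i| R_a` form a Kraus family of the measurement map. -/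
lemma POVM.exists_isKrausFamily_measure {α n : Type*} [Fintype α] [DecidableEq α] [Fintype n]
    [DecidableEq n] (M : POVM α n) :
    ∃ K : α × n → Matrix α n ℂ, IsKrausFamily K M.measure := by
  have hR (a : α) : ∃ R : Matrix n n ℂ, M.op a = Rᴴ * R := by
    open scoped MatrixOrder in
    exact CStarAlgebra.nonneg_iff_eq_star_mul_self.1 (M.op_posSemidef a).nonneg
  choose R hR using hR
  refine ⟨fun k => single k.1 k.2 (1 : ℂ) * R k.1, ?_, fun X => ?_⟩
  · rw [← M.sum_op, Fintype.sum_prod_type]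
    refine Finset.sum_congr rfl fun a _ => ?_
    have h1 : ∑ i : n, single i i (1 : ℂ) = 1 := by
      ext i j
      simp [Matrix.sum_apply, single_apply, one_apply, ite_and]
    have (i : n) : (single a i (1 : ℂ) * R a)ᴴ * (single a i (1 : ℂ) * R a) =
        (R a)ᴴ * (single i i (1 : ℂ) * R a) := by
      rw [conjTranspose_mul, conjTranspose_single, star_one, Matrix.mul_assoc,
        ← Matrix.mul_assoc (single i a 1), single_mul_single_same, mul_one]
    simp only [this, ← Matrix.mul_sum, ← Matrix.sum_mul, h1, Matrix.one_mul, hR]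
  · change ∑ a, (X * M.op a).trace • single a a (1 : ℂ) = _
    rw [Fintype.sum_prod_type]
    refine Finset.sum_congr rfl fun a _ => ?_
    have (i : n) : single a i (1 : ℂ) * R a * X * (single a i (1 : ℂ) * R a)ᴴ =
        (R a * X * (R a)ᴴ) i i • single a a (1 : ℂ) := by
      rw [conjTranspose_mul, conjTranspose_single, star_one, Matrix.mul_assoc, Matrix.mul_assoc,
        ← Matrix.mul_assoc X, ← Matrix.mul_assoc (R a), ← Matrix.mul_assoc (R a),
        ← Matrix.mul_assoc (single a i 1), single_mul_mul_single]
      simp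
    simp only [this, ← Finset.sum_smul]
    congr 1
    rw [hR, ← Matrix.mul_assoc, Matrix.trace_mul_comm, ← Matrix.mul_assoc]
    rfl

variable {m m' n n' : Type*} [Fintype m] [DecidableEq m] [Fintype m'] [DecidableEq m']
  [Fintype n] [DecidableEq n] [Fintype n'] [DecidableEq n']

lemma tensorMap_kronecker (Φ : Matrix m m ℂ →ₗ[ℂ] Matrix m' m' ℂ)
    (Ψ : Matrix n n ℂ →ₗ[ℂ] Matrix n' n' ℂ) (X : Matrix m m ℂ) (Y : Matrix n n ℂ) :
    tensorMap Φ Ψ (X ⊗ₖ Y) = Φ X ⊗ₖ Ψ Y := by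
  simp [tensorMap]

lemma linearMap_ext_kronecker {V : Type*} [AddCommMonoid V] [Module ℂ V]
    {f g : Matrix (m × n) (m × n) ℂ →ₗ[ℂ] V}
    (h : ∀ (X : Matrix m m ℂ) (Y : Matrix n n ℂ), f (X ⊗ₖ Y) = g (X ⊗ₖ Y)) : f = g := by
  have : f ∘ₗ (kroneckerLinearEquiv m m n n ℂ).toLinearMap =
      g ∘ₗ (kroneckerLinearEquiv m m n n ℂ).toLinearMap :=
    TensorProduct.ext' fun X Y => by simpa using h X Y
  ext1 Z
  simpa using LinearMap.congr_fun this ((kroneckerLinearEquiv m m n n ℂ).symm Z)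

lemma tensorMap_comp {m'' n'' : Type*} [Fintype m''] [DecidableEq m''] [Fintype n'']
    [DecidableEq n''] (Φ' : Matrix m' m' ℂ →ₗ[ℂ] Matrix m'' m'' ℂ)
    (Ψ' : Matrix n' n' ℂ →ₗ[ℂ] Matrix n'' n'' ℂ) (Φ : Matrix m m ℂ →ₗ[ℂ] Matrix m' m' ℂ)
    (Ψ : Matrix n n ℂ →ₗ[ℂ] Matrix n' n' ℂ) :
    tensorMap (Φ' ∘ₗ Φ) (Ψ' ∘ₗ Ψ) = tensorMap Φ' Ψ' ∘ₗ tensorMap Φ Ψ :=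
  linearMap_ext_kronecker fun X Y => by simp [tensorMap_kronecker]

lemma sum_kronecker_sum {κ l a b c d : Type*} [Fintype κ] [Fintype l] (X : κ → Matrix a b ℂ)
    (Y : l → Matrix c d ℂ) :
    (∑ k, X k) ⊗ₖ (∑ k, Y k) = ∑ k : κ × l, X k.1 ⊗ₖ Y k.2 := by
  ext i j
  simp [Matrix.sum_apply, Finset.sum_mul_sum, Fintype.sum_prod_type]

lemma IsKrausFamily.tensorMap {κ l : Type*} [Fintype κ] [Fintype l]
    {Φ : Matrix m m ℂ →ₗ[ℂ] Matrix m' m' ℂ} {Ψ : Matrix n n ℂ →ₗ[ℂ] Matrix n' n' ℂ}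
    {K : κ → Matrix m' m ℂ} {L : l → Matrix n' n ℂ}
    (hK : IsKrausFamily K Φ) (hL : IsKrausFamily L Ψ) :
    IsKrausFamily (fun k : κ × l => K k.1 ⊗ₖ L k.2) (tensorMap Φ Ψ) where
  sum_conjTranspose_mul_self := by
    simp only [conjTranspose_kronecker, ← mul_kronecker_mul]
    rw [← sum_kronecker_sum (fun k => (K k)ᴴ * K k) fun k => (L k)ᴴ * L k,
      hK.sum_conjTranspose_mul_self, hL.sum_conjTranspose_mul_self,
      one_kronecker_one]
  apply_eq Z := by
    -- Both sides are linear in `Z`, so it suffices to compare them on Kronecker products.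
    let F : Matrix (m × n) (m × n) ℂ →ₗ[ℂ] Matrix (m' × n') (m' × n') ℂ :=
      { toFun Z := ∑ k : κ × l, (K k.1 ⊗ₖ L k.2) * Z * (K k.1 ⊗ₖ L k.2)ᴴ
        map_add' X Y := by simp [Matrix.mul_add, Matrix.add_mul, Finset.sum_add_distrib]
        map_smul' c X := by simp [Finset.smul_sum] }
    suffices h : _root_.tensorMap Φ Ψ = F from LinearMap.congr_fun h Z
    refine linearMap_ext_kronecker fun X Y => ?_
    change _ = ∑ k : κ × l, (K k.1 ⊗ₖ L k.2) * (X ⊗ₖ Y) * (K k.1 ⊗ₖ L k.2)ᴴ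
    simp only [conjTranspose_kronecker, ← mul_kronecker_mul]
    rw [← sum_kronecker_sum (fun k => K k * X * (K k)ᴴ) fun k => L k * Y * (L k)ᴴ,
      tensorMap_kronecker, hK.apply_eq, hL.apply_eq]

end Channels

/-- Holevo bound for partial measurements. -/
theorem mainTheorem6 {ι A B α β : Type*} [Fintype ι]
    [Fintype A] [DecidableEq A] [Fintype B] [DecidableEq B]
    [Fintype α] [DecidableEq α] [Fintype β] [DecidableEq β]
    (E : WeightedFamily ι (A × B)) (hE : E.IsEnsemble)
    (MA : POVM α A) (MB : POVM β B) :
    (E.map (tensorMap LinearMap.id MB.measure)).holevoChi ≤ E.holevoChi ∧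
    (E.map (tensorMap MA.measure MB.measure)).holevoChi ≤
      (E.map (tensorMap LinearMap.id MB.measure)).holevoChi := by
  obtain ⟨K, hK⟩ := MA.exists_isKrausFamily_measure
  obtain ⟨L, hL⟩ := MB.exists_isKrausFamily_measure
  have hB := isKrausFamily_id (n := A).tensorMap hL
  refine ⟨hE.holevoChi_map_le hB, ?_⟩
  have hcomp : tensorMap MA.measure MB.measure =
      tensorMap MA.measure LinearMap.id ∘ₗ tensorMap LinearMap.id MB.measure := by
    rw [← tensorMap_comp, LinearMap.comp_id, LinearMap.id_comp]
  rw [hcomp, WeightedFamily.map_comp]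
  exact (hE.map_kraus hB).holevoChi_map_le (hK.tensorMap isKrausFamily_id)
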